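/- Let $\mathcal S,\mathcal A,\mathcal I$ be finite sets with $\mathcal A\neq\emptyset$, let $H$ be the horizon, and number the stages $h=0,1,\dots,H-1$. Let $\alpha$ be a probability distribution on $\mathcal S$, $r_h:\mathcal S\times\mathcal A\to[0,1]$ rewards, $\widehat P_h(\cdot\mid x,a)$ a reference transition probability function, $w_{h,i}:\mathcal S\to\mathbb R$ constraint-aggregation functions and $b_{h,i}:\mathcal S\times\mathcal A\to[0,\infty)$ confidence widths, $i\in\mathcal I$ (the case in which none of them depends on $h$ is included). The primal optimistic linear program is to maximize $\sum_{h,x,a,x'}q_h(x,a,x')r_h(x,a)$ over $q\ge0$, $\varepsilon\ge0$ subject to $$\sum_{a,x'}q_0(x,a,x')=\alpha(x),\qquad \sum_{a,x'}q_h(x,a,x')=\sum_{z,a}q_{h-1}(z,a,x)\quad(1\le h\le H-1),$$ $$\Bigl|q_h(x,a,x')-\widehat P_h(x'\mid x,a)\sum_y q_h(x,a,y)\Bigr|\le\varepsilon_h(x,a,x'),\qquad \sum_y w_{h,i}(y)\,\varepsilon_h(x,a,y)\le b_{h,i}(x,a)\sum_y q_h(x,a,y)$$ (the absolute value standing for two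 linear inequalities). Its dual is its Lagrangian linear-programming dual, with free multipliers $\beta_h(x)$, $0\le h\le H-1$, for the equality constraints and nonnegative multipliers for the inequalities other than $q,\varepsilon\ge 0$; put $\beta_H=0$. Then there are a bonus function $\mathrm{CB}:\mathcal S\times\mathcal A\times\{0,\dots,H-1\}\to\mathbb R_+$ and a function $\beta^*=(\beta^*_h)_{0\le h\le H}$ with $\beta^*_H=0$ such that the following holds. 1. The dual can be written as the optimistic Bellman linear program $$\text{minimize }\sum_x\alpha(x)\beta_0(x)\quad\text{subject to}\quad \beta_h(x)\ge r_h(x,a)+\mathrm{CB}_h(x,a)+\sum_y\widehat P_h(y\mid x,a)\beta_{h+1}(y)\ \ \forall x,a,h,\qquad \beta_H=0,$$ in the following sense. $\beta^*$ is an optimal solution of this program, and is its componentwise least feasible point; $\beta^*$ together with suitable values of the other multipliers is an optimal solution of the dual; the optimal values of the primal program, of its dual and of the Bellman program are attained and all equal to $\sum_x\alpha(x)\beta_0^*(x)$. Moreover $\mathrm{CB}_h(x,a)=B_h(\beta^*_{h+1})(x,a)$ for maps $B_h:\mathbb R^{\mathcal S}\to\mathbb R_+^{\mathcal S\times\mathcal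 A}$ such that a function $\beta$ with $\beta_H=0$ extends by suitable values of the other multipliers to a feasible point of the dual if and only if $\beta_h(x)\ge r_h(x,a)+B_h(\beta_{h+1})(x,a)+\sum_y\widehat P_h(y\mid x,a)\beta_{h+1}(y)$ for all $x,a,h$, and the dual objective is then $\sum_x\alpha(x)\beta_0(x)$. 2. Let $(q^*,\varepsilon^*)$ be any optimal solution of the primal program, and let $\pi^+_h(a\mid x)=\sum_{x'}q^*_h(x,a,x')/\sum_{a',x'}q^*_h(x,a',x')$ be the extracted policy, defined where the denominator is nonzero and arbitrary elsewhere. Whenever the denominator is nonzero and $\pi^+_h(a\mid x)>0$, $$\beta^*_h(x)=r_h(x,a)+\mathrm{CB}_h(x,a)+\sum_y\widehat P_h(y\mid x,a)\beta^*_{h+1}(y).$$ In particular there is a deterministic policy $\pi^+$ that plays only actions of positive probability at the states where the denominator is nonzero, and for which this equality with $a=\pi^+_h(x)$ holds for all $x\in\mathcal S$ and all $h$. 3. If the true transition function $P$ satisfies $\sum_{y}w_{h,i}(y)\,|P_h(y\mid x,a)-\widehat P_h(y\mid x,a)|\le b_{h,i}(x,a)$ for all $h,i,x,a$, then $V^*_h(x)\le\beta^*_h(x)\le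 H-h$ for all $x\in\mathcal S$ and $0\le h\le H$, where $V^*_h(x)$ is the maximum over deterministic policies of the expected total reward under $P$ collected in stages $h,\dots,H-1$ from $x$. -/

import Mathlib

/-- A stage-dependent transition function on finite `S`, `A`, with stages `0, …, H - 1`:
`P h x a y` is the probability of moving from `x` to `y` under action `a` in stage `h`. -/
structure IsTransition {S A : Type*} [Fintype S] {H : ℕ} (P : Fin H → S → A → S → ℝ) : Prop where
  nonneg : ∀ h x a y, 0 ≤ P h x a y
  sum_one : ∀ h x a, ∑ y, P h x a y = 1

/-- The data of the optimistic planning problem: initial distribution `α`, rewards `r` in `[0,1]`,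
reference transition function `Phat`, constraint-aggregation functions `w` and nonnegative
confidence widths `b`, indexed by `I`. Stages are numbered `0, …, H - 1`. -/
structure OptimisticModel (S A I : Type*) [Fintype S] (H : ℕ) where
  α : S → ℝ
  r : Fin H → S → A → ℝ
  Phat : Fin H → S → A → S → ℝ
  w : Fin H → I → S → ℝ
  b : Fin H → I → S → A → ℝ
  α_nonneg : ∀ x, 0 ≤ α x
  α_sum : ∑ x, α x = 1
  r_nonneg : ∀ h x a, 0 ≤ r h x a
  r_le_one : ∀ h x a, r h x a ≤ 1
  Phat_transition : IsTransition Phat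
  b_nonneg : ∀ h i x a, 0 ≤ b h i x a

/-- Lagrange multipliers of the primal program: `β` for the initial and flow equalities,
`μp` and `μm` for the two families of deviation inequalities, `μ` for the aggregated
confidence inequalities. -/
structure Multipliers (S A I : Type*) (H : ℕ) where
  β : Fin H → S → ℝ
  μp : Fin H → S → A → S → ℝ
  μm : Fin H → S → A → S → ℝ
  μ : Fin H → I → S → A → ℝ

namespace Multipliers

/-- The multipliers of the inequality constraints are nonnegative; `β` is free. -/
structure Nonneg {S A I : Type*} {H : ℕ} (m : Multipliers S A I H) : Prop where
  μp : ∀ h x a y, 0 ≤ m.μp h x a y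
  μm : ∀ h x a y, 0 ≤ m.μm h x a y
  μ : ∀ h i x a, 0 ≤ m.μ h i x a

end Multipliers

namespace OptimisticModel

variable {S A I : Type*} [Fintype S] [Fintype A] [Fintype I] {H : ℕ}

/-- Mass of `q h` at the state `x`. -/
def outflow (q : Fin H → S → A → S → ℝ) (h : Fin H) (x : S) : ℝ :=
  ∑ a, ∑ y, q h x a y

/-- Mass that has to be at `x` in stage `h`: the initial distribution if `h = 0`, and what stage
`h - 1` sends to `x` otherwise. -/
def inflow (M : OptimisticModel S A I H) (q : Fin H → S → A → S → ℝ) (h : Fin H) (x : S) : ℝ :=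
  if (h : ℕ) = 0 then M.α x
  else ∑ z, ∑ a, q ⟨(h : ℕ) - 1, lt_of_le_of_lt (Nat.sub_le _ _) h.isLt⟩ z a x

/-- The total reward of `q`. -/
def primalObj (M : OptimisticModel S A I H) (q : Fin H → S → A → S → ℝ) : ℝ :=
  ∑ h, ∑ x, ∑ a, ∑ y, q h x a y * M.r h x a

/-- Feasibility in the primal optimistic linear program: `q` lies in the flow polytope, `ε ≥ 0`,
and the deviation and aggregated confidence constraints hold. -/
structure PrimalFeasible (M : OptimisticModel S A I H) (q ε : Fin H → S → A → S → ℝ) : Prop where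
  q_nonneg : ∀ h x a y, 0 ≤ q h x a y
  ε_nonneg : ∀ h x a y, 0 ≤ ε h x a y
  flow : ∀ h x, outflow q h x = M.inflow q h x
  dev_pos : ∀ h x a y, q h x a y - M.Phat h x a y * ∑ z, q h x a z ≤ ε h x a y
  dev_neg : ∀ h x a y, M.Phat h x a y * ∑ z, q h x a z - q h x a y ≤ ε h x a y
  conf : ∀ h i x a, ∑ y, M.w h i y * ε h x a y ≤ M.b h i x a * ∑ y, q h x a y

/-- `(q, ε)` is an optimal solution of the primal optimistic linear program. -/
def PrimalOptimal (M : OptimisticModel S A I H) (q ε : Fin H → S → A → S → ℝ) : Prop :=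
  M.PrimalFeasible q ε ∧ ∀ q' ε', M.PrimalFeasible q' ε' → M.primalObj q' ≤ M.primalObj q

/-- The Lagrangian of the primal program (a maximization over `q, ε ≥ 0`). -/
def lagrangian (M : OptimisticModel S A I H) (q ε : Fin H → S → A → S → ℝ)
    (m : Multipliers S A I H) : ℝ :=
  M.primalObj q
    + ∑ h, ∑ x, m.β h x * (M.inflow q h x - outflow q h x)
    + ∑ h, ∑ x, ∑ a, ∑ y,
        m.μp h x a y * (ε h x a y - (q h x a y - M.Phat h x a y * ∑ z, q h x a z))
    + ∑ h, ∑ x, ∑ a, ∑ y,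
        m.μm h x a y * (ε h x a y - (M.Phat h x a y * ∑ z, q h x a z - q h x a y))
    + ∑ h, ∑ i, ∑ x, ∑ a,
        m.μ h i x a * (M.b h i x a * ∑ y, q h x a y - ∑ y, M.w h i y * ε h x a y)

/-- `m` is feasible in the dual linear program of the primal program, with dual objective `v`:
the inequality multipliers are nonnegative and the dual function
`sup {lagrangian q ε m | q, ε ≥ 0}` is finite and equal to `v`. The dual program is to
minimize this `v`. -/
def IsDualValue (M : OptimisticModel S A I H) (m : Multipliers S A I H) (v : ℝ) : Prop :=
  m.Nonneg ∧
    IsLUB {l : ℝ | ∃ q ε : Fin H → S → A → S → ℝ, (∀ h x a y, 0 ≤ q h x a y) ∧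
      (∀ h x a y, 0 ≤ ε h x a y) ∧ l = M.lagrangian q ε m} v

/-- The objective `∑ α(x) β₀(x)`. -/
def initialValue (M : OptimisticModel S A I H) (β : Fin (H + 1) → S → ℝ) : ℝ :=
  ∑ x, M.α x * β 0 x

/-- The right-hand side `r + c + P̂ v` of a Bellman inequality, where `c` is the bonus. -/
def backup (M : OptimisticModel S A I H) (h : Fin H) (x : S) (a : A) (c : ℝ) (v : S → ℝ) : ℝ :=
  M.r h x a + c + ∑ y, M.Phat h x a y * v y

/-- Feasibility in the optimistic Bellman linear program with bonus function `CB`;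
`β` has the terminal value `0` after the last stage. -/
def BellmanFeasible (M : OptimisticModel S A I H) (CB : Fin H → S → A → ℝ)
    (β : Fin (H + 1) → S → ℝ) : Prop :=
  (∀ x, β (Fin.last H) x = 0) ∧
    ∀ h x a, M.backup h x a (CB h x a) (β h.succ) ≤ β h.castSucc x

/-- The stochastic policy induced by `q`: the probability of action `a` in state `x`, stage `h`
(equal to `0` for all `a` if `x` carries no mass in stage `h`, where the policy is not
determined by `q`). -/
noncomputable def inducedPolicy (q : Fin H → S → A → S → ℝ) (h : Fin H) (x : S) (a : A) : ℝ :=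
  (∑ y, q h x a y) / outflow q h x

/-- A deterministic policy is extracted from `q` if in every stage and in every state of positive
mass it plays an action that the induced stochastic policy plays with positive probability.
It is arbitrary at the other states. -/
def IsExtracted (q : Fin H → S → A → S → ℝ) (π : Fin H → S → A) : Prop :=
  ∀ h x, 0 < outflow q h x → 0 < inducedPolicy q h x (π h x)

/-- The transition function `P` satisfies the aggregated confidence constraints around `Phat`. -/
def InConfidenceSet (M : OptimisticModel S A I H) (P : Fin H → S → A → S → ℝ) : Prop :=
  ∀ h i x a, ∑ y, M.w h i y * |P h x a y - M.Phat h x a y| ≤ M.b h i x a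

end OptimisticModel

section Values

variable {S A : Type*} [Fintype S] {H : ℕ}

/-- The stage that is `k` steps after stage `h`. -/
def stageAfter (h : Fin (H + 1)) (k : Fin (H - (h : ℕ))) : Fin H :=
  ⟨(h : ℕ) + (k : ℕ), by have := k.isLt; omega⟩

/-- Value function of the policy `π` under the transition function `P`: the expected total reward
from stage `h` on, given that the state in stage `h` is `x`. The expectation is the sum over all
sequences `ω` of subsequent states of the probability of the trajectory `x, ω₀, ω₁, …` times the
reward collected on it. -/
def policyValue (P : Fin H → S → A → S → ℝ) (r : Fin H → S → A → ℝ) (π : Fin H → S → A)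
    (h : Fin (H + 1)) (x : S) : ℝ :=
  ∑ ω : Fin (H - (h : ℕ)) → S,
    let s : Fin (H - (h : ℕ) + 1) → S := Fin.cons x ω
    (∏ k, P (stageAfter h k) (s k.castSucc) (π (stageAfter h k) (s k.castSucc)) (s k.succ)) *
      ∑ k, r (stageAfter h k) (s k.castSucc) (π (stageAfter h k) (s k.castSucc))

/-- The optimal value function: the maximum of the values of all (finitely many) policies. -/
noncomputable def optimalValue (P : Fin H → S → A → S → ℝ) (r : Fin H → S → A → ℝ)
    (h : Fin (H + 1)) (x : S) : ℝ :=
  ⨆ π : Fin H → S → A, policyValue P r π h x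

end Values

/-! For fixed stage, state and action, the constraints on the slices of `q` and `ε` cut out a
polyhedral cone. Its points of mass one are the plausible next-state distributions, and
`optExpectation` is the support function `σ(v)` of this set. The bonus is `σ(v) - P̂ v`, so a
Bellman inequality with bonus reads `β_h ≥ r + σ(β_{h+1})`.

The dual: by `lagrangian_eq` the Lagrangian is affine in `q` and `ε`, so its supremum over the
orthant is finite exactly when all coefficients are nonpositive. For given `β` these conditions
decouple over stage, state and action. By Farkas' lemma (`optExpectation_le_iff`) the remaining
multipliers exist exactly when `σ(β_{h+1}) ≤ β_h - r`.

Backward recursion solves the Bellman inequalities with equality at a maximizing action. With the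
bonus frozen at this solution, the right-hand side is monotone in `β`, so the solution is the least
feasible point. Moving mass forward along maximizing actions and kernels gives a primal point of the
same value, whence strong duality. The gap between the two values is a sum of nonnegative terms,
which gives complementary slackness. Optimism is backward induction: a true kernel in the confidence
set competes in the maximum defining `σ`. -/

/-! ### Farkas' lemma and attainment of linear programs -/

section Farkas

variable {V ι : Type*} [AddCommGroup V] [Module ℝ V]

/-- **Farkas' lemma** for finitely many linear functionals: a functional that is nonnegative
wherever all the `a i` are is a nonnegative combination of them. -/
theorem farkas_finset (s : Finset ι) (a : ι → V →ₗ[ℝ] ℝ) (c : V →ₗ[ℝ] ℝ)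
    (hc : ∀ x, (∀ i ∈ s, 0 ≤ a i x) → 0 ≤ c x) :
    ∃ l : ι → ℝ, (∀ i, 0 ≤ l i) ∧ ∀ x, c x = ∑ i ∈ s, l i * a i x := by
  classical
  induction s using Finset.induction_on generalizing a c with
  | empty =>
    refine ⟨0, fun _ => le_rfl, fun x => ?_⟩
    have h1 := hc x (by simp)
    have h2 := hc (-x) (by simp)
    rw [map_neg] at h2
    simp only [Finset.sum_empty]
    linarith
  | insert j s hj ih =>
    by_cases H : ∀ x, (∀ i ∈ s, 0 ≤ a i x) → 0 ≤ c x
    · obtain ⟨l, hl, hs⟩ := ih a c H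
      refine ⟨Function.update l j 0, fun i => ?_, fun x => ?_⟩
      · by_cases hi : i = j
        · simp [hi]
        · simpa [hi] using hl i
      · rw [Finset.sum_insert hj, hs x]
        simp only [Function.update_self, zero_mul, zero_add]
        refine Finset.sum_congr rfl fun i hi => ?_
        rw [Function.update_of_ne (fun h : i = j => hj (h ▸ hi))]
    · push Not at H
      obtain ⟨z, hz, hcz⟩ := H
      have hjz : a j z < 0 := by
        by_contra hn
        push Not at hn
        exact absurd (hc z (by simpa using ⟨hn, hz⟩)) (not_le.mpr hcz)
      -- Each modified functional is the original one evaluated at the projection of `x` along `z`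
      -- onto the kernel of `a j`. There constraint `j` holds with equality, so only those in `s`
      -- remain.
      obtain ⟨l, hl, hs⟩ := ih (fun i => a i - (a i z / a j z) • a j)
        (c - (c z / a j z) • a j) (fun x hx => by
          have key : ∀ f : V →ₗ[ℝ] ℝ, f (x - (a j x / a j z) • z) =
              (f - (f z / a j z) • a j) x := fun f => by
            simp only [map_sub, map_smul, smul_eq_mul, LinearMap.sub_apply, LinearMap.smul_apply]
            ring
          rw [← key]
          refine hc _ fun i hi => ?_
          rcases Finset.mem_insert.mp hi with rfl | hi
          · rw [key]
            simp [hjz.ne]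
          · rw [key]
            exact hx i hi)
      refine ⟨Function.update l j (c z / a j z - ∑ i ∈ s, l i * (a i z / a j z)),
        fun i => ?_, fun x => ?_⟩
      · by_cases hi : i = j
        · subst hi
          rw [Function.update_self]
          have h1 : 0 ≤ c z / a i z := div_nonneg_of_nonpos hcz.le hjz.le
          have h2 : ∑ k ∈ s, l k * (a k z / a i z) ≤ 0 :=
            Finset.sum_nonpos fun k hk => mul_nonpos_of_nonneg_of_nonpos (hl k)
              (div_nonpos_of_nonneg_of_nonpos (hz k hk) hjz.le)
          linarith
        · simpa [hi] using hl i
      · rw [Finset.sum_insert hj, Function.update_self]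
        have h1 : ∑ i ∈ s, Function.update l j (c z / a j z - ∑ i ∈ s, l i * (a i z / a j z)) i
            * a i x = ∑ i ∈ s, l i * a i x := by
          refine Finset.sum_congr rfl fun i hi => ?_
          rw [Function.update_of_ne (fun h : i = j => hj (h ▸ hi))]
        have h2 := hs x
        simp only [LinearMap.sub_apply, LinearMap.smul_apply, smul_eq_mul, mul_sub,
          Finset.sum_sub_distrib] at h2
        have h3 : ∑ i ∈ s, l i * (a i z / a j z * a j x) =
            (∑ i ∈ s, l i * (a i z / a j z)) * a j x := by
          rw [Finset.sum_mul]
          exact Finset.sum_congr rfl fun i _ => by ring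
        rw [h1]
        linarith

/-- A linear program over the slice `e = 1` of a polyhedral cone attains its optimum as soon as
it is feasible and bounded. -/
theorem exists_max_on_cone [Fintype ι] (a : ι → V →ₗ[ℝ] ℝ) (e g : V →ₗ[ℝ] ℝ)
    (he : ∀ x, (∀ i, 0 ≤ a i x) → 0 ≤ e x) (hne : ∃ x, (∀ i, 0 ≤ a i x) ∧ e x = 1)
    (C : ℝ) (hC : ∀ x, (∀ i, 0 ≤ a i x) → g x ≤ C * e x) :
    ∃ x, (∀ i, 0 ≤ a i x) ∧ e x = 1 ∧ ∀ y, (∀ i, 0 ≤ a i y) → g y ≤ g x * e y := by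
  set T : Set ℝ := {t | ∃ x, (∀ i, 0 ≤ a i x) ∧ e x = 1 ∧ t = g x} with hT
  have hTne : T.Nonempty := by
    obtain ⟨x, hx, hex⟩ := hne
    exact ⟨g x, x, hx, hex, rfl⟩
  have hTb : BddAbove T := by
    refine ⟨C, ?_⟩
    rintro _ ⟨x, hx, hex, rfl⟩
    simpa [hex] using hC x hx
  have scale : ∀ y, (∀ i, 0 ≤ a i y) → 0 < e y → (∀ i, 0 ≤ a i ((e y)⁻¹ • y)) ∧
      e ((e y)⁻¹ • y) = 1 := fun y hy hey =>
    ⟨fun i => by rw [map_smul]; exact mul_nonneg (inv_nonneg.mpr hey.le) (hy i),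
      by rw [map_smul, smul_eq_mul, inv_mul_cancel₀ hey.ne']⟩
  have hle : ∀ y, (∀ i, 0 ≤ a i y) → g y ≤ sSup T * e y := by
    intro y hy
    -- Directions with `e y = 0` cannot be rescaled into the slice; for them the bound `hC` gives `g
    -- y ≤ 0`.
    rcases (he y hy).eq_or_lt with h0 | hpos
    · have := hC y hy
      rw [← h0] at this ⊢
      simpa using this
    · obtain ⟨h1, h2⟩ := scale y hy hpos
      have := le_csSup hTb ⟨_, h1, h2, rfl⟩
      rw [map_smul, smul_eq_mul, inv_mul_le_iff₀ hpos] at this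
      linarith
  suffices h : ∃ x, (∀ i, 0 ≤ a i x) ∧ 0 < e x ∧ sSup T * e x ≤ g x by
    obtain ⟨x, hx, hpos, hg⟩ := h
    obtain ⟨h1, h2⟩ := scale x hx hpos
    refine ⟨_, h1, h2, fun y hy => (hle y hy).trans (mul_le_mul_of_nonneg_right ?_ (he y hy))⟩
    rw [map_smul, smul_eq_mul, le_inv_mul_iff₀ hpos]
    linarith
  by_contra hno
  push Not at hno
  -- Without a maximizer, `g - sSup T • e ≥ 0` forces `e = 0` on the cone. The Farkas certificate
  -- for `-e` then keeps `g` at least `(l none)⁻¹` below the supremum on the whole slice.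
  obtain ⟨l, hl, hs⟩ := farkas_finset (Finset.univ : Finset (Option ι))
    (fun o => o.elim (g - sSup T • e) a) (-e) (fun x hx => by
      have h1 := hx none (Finset.mem_univ _)
      simp only [Option.elim, LinearMap.sub_apply, LinearMap.smul_apply, smul_eq_mul] at h1
      have h2 : ∀ i, 0 ≤ a i x := fun i => hx (some i) (Finset.mem_univ _)
      rw [LinearMap.neg_apply]
      by_contra hn
      have := hno x h2 (by linarith)
      linarith)
  have hgap : ∀ x, (∀ i, 0 ≤ a i x) → e x = 1 → 1 ≤ l none * (sSup T - g x) := by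
    intro x hx hex
    have h1 := hs x
    rw [Fintype.sum_option] at h1
    simp only [Option.elim, LinearMap.sub_apply, LinearMap.smul_apply, smul_eq_mul,
      LinearMap.neg_apply, hex] at h1
    have h2 : 0 ≤ ∑ i, l (some i) * a i x :=
      Finset.sum_nonneg fun i _ => mul_nonneg (hl _) (hx i)
    linarith
  have hpos : 0 < l none := by
    obtain ⟨x, hx, hex⟩ := hne
    refine (hl none).lt_of_ne fun h0 => ?_
    have := hgap x hx hex
    rw [← h0] at this
    linarith
  have : sSup T ≤ sSup T - (l none)⁻¹ := by
    refine csSup_le hTne ?_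
    rintro _ ⟨x, hx, hex, rfl⟩
    have h1 := hgap x hx hex
    have h2 : (l none)⁻¹ ≤ sSup T - g x := by
      rw [inv_le_iff_one_le_mul₀ hpos]
      linarith
    linarith
  have := inv_pos.mpr hpos
  linarith

end Farkas

/-! ### The confidence cone, its support function and the bonus -/

namespace OptimisticModel

variable {S A I : Type*} [Fintype S] {H : ℕ}

/-- The homogeneous confidence constraints at one stage, state and action: `p` is a (not
normalized) next-state measure and `ε` bounds its deviation from `Phat`. -/
structure InConfidenceCone (M : OptimisticModel S A I H) (h : Fin H) (x : S) (a : A)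
    (p ε : S → ℝ) : Prop where
  p_nonneg : ∀ y, 0 ≤ p y
  ε_nonneg : ∀ y, 0 ≤ ε y
  dev_pos : ∀ y, p y - M.Phat h x a y * ∑ z, p z ≤ ε y
  dev_neg : ∀ y, M.Phat h x a y * ∑ z, p z - p y ≤ ε y
  conf : ∀ i, ∑ y, M.w h i y * ε y ≤ M.b h i x a * ∑ y, p y

/-- The linear functionals whose nonnegativity defines the confidence cone. -/
noncomputable def coneFunctional (M : OptimisticModel S A I H) (h : Fin H) (x : S) (a : A) :
    S ⊕ S ⊕ S ⊕ S ⊕ I → ((S → ℝ) × (S → ℝ)) →ₗ[ℝ] ℝ :=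
  let P : S → ((S → ℝ) × (S → ℝ)) →ₗ[ℝ] ℝ := fun y => LinearMap.proj y ∘ₗ LinearMap.fst ℝ _ _
  let E : S → ((S → ℝ) × (S → ℝ)) →ₗ[ℝ] ℝ := fun y => LinearMap.proj y ∘ₗ LinearMap.snd ℝ _ _
  Sum.elim P <| Sum.elim E <|
    Sum.elim (fun y => E y - (P y - M.Phat h x a y • ∑ z, P z)) <|
    Sum.elim (fun y => E y - (M.Phat h x a y • ∑ z, P z - P y))
      (fun i => M.b h i x a • ∑ y, P y - ∑ y, M.w h i y • E y)

theorem coneFunctional_nonneg_iff (M : OptimisticModel S A I H) (h : Fin H) (x : S) (a : A)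
    (z : (S → ℝ) × (S → ℝ)) :
    (∀ j, 0 ≤ M.coneFunctional h x a j z) ↔ M.InConfidenceCone h x a z.1 z.2 := by
  constructor
  · intro hz
    simp only [coneFunctional, Sum.forall, Sum.elim_inl, Sum.elim_inr] at hz
    obtain ⟨h1, h2, h3, h4, h5⟩ := hz
    refine ⟨fun y => by simpa using h1 y, fun y => by simpa using h2 y,
      fun y => by simpa using h3 y, fun y => by simpa using h4 y, fun i => by simpa using h5 i⟩
  · rintro ⟨h1, h2, h3, h4, h5⟩
    simp only [coneFunctional, Sum.forall, Sum.elim_inl, Sum.elim_inr]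
    refine ⟨fun y => by simpa using h1 y, fun y => by simpa using h2 y,
      fun y => by simpa using h3 y, fun y => by simpa using h4 y, fun i => by simpa using h5 i⟩

/-- Zero deviation is admissible because the widths are nonnegative. This point makes the
maximization feasible and the bonus nonnegative. -/
theorem inConfidenceCone_Phat (M : OptimisticModel S A I H) (h : Fin H) (x : S) (a : A) :
    M.InConfidenceCone h x a (M.Phat h x a) 0 := by
  have h1 := M.Phat_transition.sum_one h x a
  refine ⟨M.Phat_transition.nonneg h x a, fun _ => le_rfl, fun y => ?_, fun y => ?_, fun i => ?_⟩
  · simp [h1]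
  · simp [h1]
  · simpa [h1] using M.b_nonneg h i x a

theorem inConfidenceCone_of_inConfidenceSet (M : OptimisticModel S A I H)
    {P : Fin H → S → A → S → ℝ} (hP : IsTransition P) (hM : M.InConfidenceSet P)
    (h : Fin H) (x : S) (a : A) :
    M.InConfidenceCone h x a (P h x a) (fun y => |P h x a y - M.Phat h x a y|) := by
  have h1 := hP.sum_one h x a
  refine ⟨hP.nonneg h x a, fun _ => abs_nonneg _, fun y => ?_, fun y => ?_, fun i => ?_⟩
  · rw [h1, mul_one]
    exact le_abs_self _
  · rw [h1, mul_one, abs_sub_comm]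
    exact le_abs_self _
  · simpa [h1] using hM h i x a

variable [Fintype I]

/-- Since `w` has no sign, `ε` may be unbounded, so attainment is drawn from polyhedrality rather
than compactness. Maximality is stated homogeneously, so that it applies to slices of `q` of any
mass, including zero. -/
theorem exists_optimal_kernel (M : OptimisticModel S A I H) (h : Fin H) (x : S) (a : A)
    (v : S → ℝ) :
    ∃ p ε, M.InConfidenceCone h x a p ε ∧ ∑ y, p y = 1 ∧
      ∀ p' ε', M.InConfidenceCone h x a p' ε' →
        ∑ y, p' y * v y ≤ (∑ y, p y * v y) * ∑ y, p' y := by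
  let e : ((S → ℝ) × (S → ℝ)) →ₗ[ℝ] ℝ :=
    ∑ y, LinearMap.proj y ∘ₗ LinearMap.fst ℝ (S → ℝ) (S → ℝ)
  let g : ((S → ℝ) × (S → ℝ)) →ₗ[ℝ] ℝ :=
    ∑ y, v y • (LinearMap.proj y ∘ₗ LinearMap.fst ℝ (S → ℝ) (S → ℝ))
  have he : ∀ z, e z = ∑ y, z.1 y := fun z => by simp [e]
  have hg : ∀ z, g z = ∑ y, z.1 y * v y := fun z => by simp [g, mul_comm]
  obtain ⟨z, hz, hz1, hmax⟩ := exists_max_on_cone (M.coneFunctional h x a) e g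
    (fun z hz => by
      rw [he]
      exact Finset.sum_nonneg fun y _ => ((M.coneFunctional_nonneg_iff h x a z).1 hz).p_nonneg y)
    ⟨(M.Phat h x a, 0), (M.coneFunctional_nonneg_iff h x a _).2 (M.inConfidenceCone_Phat h x a),
      by rw [he]; exact M.Phat_transition.sum_one h x a⟩
    (∑ y, |v y|) (fun z hz => by
      rw [he, hg, Finset.mul_sum]
      refine Finset.sum_le_sum fun y _ => ?_
      have h1 := ((M.coneFunctional_nonneg_iff h x a z).1 hz).p_nonneg y
      rw [mul_comm]
      refine mul_le_mul_of_nonneg_right ((le_abs_self _).trans ?_) h1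
      exact Finset.single_le_sum (f := fun y => |v y|) (fun y _ => abs_nonneg _)
        (Finset.mem_univ y))
  refine ⟨z.1, z.2, (M.coneFunctional_nonneg_iff h x a z).1 hz, by rw [← he, hz1], ?_⟩
  intro p' ε' h'
  have := hmax (p', ε') ((M.coneFunctional_nonneg_iff h x a _).2 h')
  rwa [hg, hg, he] at this

/-- A transition probability in the confidence set that maximizes the expectation of `v`. -/
noncomputable def optKernel (M : OptimisticModel S A I H) (h : Fin H) (x : S) (a : A)
    (v : S → ℝ) : S → ℝ :=
  (M.exists_optimal_kernel h x a v).choose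

/-- Deviation bounds certifying that `optKernel` lies in the confidence set. -/
noncomputable def optDeviation (M : OptimisticModel S A I H) (h : Fin H) (x : S) (a : A)
    (v : S → ℝ) : S → ℝ :=
  (M.exists_optimal_kernel h x a v).choose_spec.choose

/-- The largest expectation of `v` under transition probabilities in the confidence set. -/
noncomputable def optExpectation (M : OptimisticModel S A I H) (h : Fin H) (x : S) (a : A)
    (v : S → ℝ) : ℝ :=
  ∑ y, M.optKernel h x a v y * v y

theorem optKernel_mem (M : OptimisticModel S A I H) (h : Fin H) (x : S) (a : A) (v : S → ℝ) :
    M.InConfidenceCone h x a (M.optKernel h x a v) (M.optDeviation h x a v) :=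
  (M.exists_optimal_kernel h x a v).choose_spec.choose_spec.1

theorem sum_optKernel (M : OptimisticModel S A I H) (h : Fin H) (x : S) (a : A) (v : S → ℝ) :
    ∑ y, M.optKernel h x a v y = 1 :=
  (M.exists_optimal_kernel h x a v).choose_spec.choose_spec.2.1

theorem InConfidenceCone.sum_le {M : OptimisticModel S A I H} {h : Fin H} {x : S} {a : A}
    {p ε : S → ℝ} (hp : M.InConfidenceCone h x a p ε) (v : S → ℝ) :
    ∑ y, p y * v y ≤ M.optExpectation h x a v * ∑ y, p y :=
  (M.exists_optimal_kernel h x a v).choose_spec.choose_spec.2.2 p ε hp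

/-- Duality for the maximization of an expectation over the confidence set. -/
theorem optExpectation_le_iff (M : OptimisticModel S A I H) (h : Fin H) (x : S) (a : A)
    (v : S → ℝ) (t : ℝ) :
    M.optExpectation h x a v ≤ t ↔ ∃ (μp μm : S → ℝ) (μ : I → ℝ),
      (∀ y, 0 ≤ μp y) ∧ (∀ y, 0 ≤ μm y) ∧ (∀ i, 0 ≤ μ i) ∧
      (∀ y, μp y + μm y ≤ ∑ i, μ i * M.w h i y) ∧
      ∀ y, v y - μp y + μm y + ∑ z, M.Phat h x a z * (μp z - μm z) + ∑ i, μ i * M.b h i x a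
        ≤ t := by
  classical
  constructor
  · intro ht
    let c : ((S → ℝ) × (S → ℝ)) →ₗ[ℝ] ℝ :=
      ∑ y, (t - v y) • (LinearMap.proj y ∘ₗ LinearMap.fst ℝ (S → ℝ) (S → ℝ))
    have hc : ∀ z, c z = ∑ y, z.1 y * (t - v y) := fun z => by simp [c, mul_comm]
    -- The last three families of Farkas coefficients are the multipliers. Testing on unit vectors
    -- in `ε` and `p` gives the two required inequalities, with the coefficients of the sign
    -- constraints as slack.
    obtain ⟨l, hl, hs⟩ := farkas_finset Finset.univ (M.coneFunctional h x a) c (fun z hz => by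
      have hz := (M.coneFunctional_nonneg_iff h x a z).1 fun j => hz j (Finset.mem_univ j)
      have h1 := hz.sum_le v
      have h2 : M.optExpectation h x a v * ∑ y, z.1 y ≤ t * ∑ y, z.1 y :=
        mul_le_mul_of_nonneg_right ht (Finset.sum_nonneg fun y _ => hz.p_nonneg y)
      rw [hc]
      simp only [mul_sub, Finset.sum_sub_distrib, ← Finset.sum_mul]
      linarith)
    refine ⟨fun y => l (.inr (.inr (.inl y))), fun y => l (.inr (.inr (.inr (.inl y)))),
      fun i => l (.inr (.inr (.inr (.inr i)))), fun _ => hl _, fun _ => hl _, fun _ => hl _,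
      fun y => ?_, fun y => ?_⟩
    · have h1 := hs (0, Pi.single y 1)
      have h2 := hl (.inr (.inl y))
      rw [hc] at h1
      simp [coneFunctional, Fintype.sum_sum_type, Pi.single_apply] at h1
      linarith
    · have h1 := hs (Pi.single y 1, 0)
      have h2 := hl (.inl y)
      rw [hc] at h1
      simp [coneFunctional, Fintype.sum_sum_type, Pi.single_apply, mul_sub,
        Finset.sum_sub_distrib] at h1
      simp only [mul_sub, Finset.sum_sub_distrib]
      simp only [mul_comm (M.Phat h x a _)]
      linarith
  · rintro ⟨μp, μm, μ, hp, hm, hμ, h1, h2⟩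
    have K := M.optKernel_mem h x a v
    have hsum := M.sum_optKernel h x a v
    set p := M.optKernel h x a v with hpdef
    set ε := M.optDeviation h x a v
    -- Weak duality: weight the multiplier inequalities by the maximizing `p` and `ε`, the cone
    -- constraints by the multipliers, and add.
    have e1 : ∑ y, p y * (v y - μp y + μm y + ∑ z, M.Phat h x a z * (μp z - μm z)
        + ∑ i, μ i * M.b h i x a) ≤ ∑ y, p y * t :=
      Finset.sum_le_sum fun y _ => mul_le_mul_of_nonneg_left (h2 y) (K.p_nonneg y)
    have e2 : ∑ y, ε y * (μp y + μm y) ≤ ∑ y, ε y * ∑ i, μ i * M.w h i y :=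
      Finset.sum_le_sum fun y _ => mul_le_mul_of_nonneg_left (h1 y) (K.ε_nonneg y)
    have e3 : ∑ y, ε y * ∑ i, μ i * M.w h i y ≤ ∑ i, μ i * M.b h i x a := by
      have : ∑ y, ε y * ∑ i, μ i * M.w h i y = ∑ i, μ i * ∑ y, M.w h i y * ε y := by
        simp only [Finset.mul_sum]
        rw [Finset.sum_comm]
        exact Finset.sum_congr rfl fun i _ => Finset.sum_congr rfl fun y _ => by ring
      rw [this]
      refine Finset.sum_le_sum fun i _ => mul_le_mul_of_nonneg_left ?_ (hμ i)
      simpa [hsum] using K.conf i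
    have e4 : ∑ y, μp y * (p y - M.Phat h x a y) ≤ ∑ y, μp y * ε y :=
      Finset.sum_le_sum fun y _ => mul_le_mul_of_nonneg_left
        (by simpa [hsum] using K.dev_pos y) (hp y)
    have e5 : ∑ y, μm y * (M.Phat h x a y - p y) ≤ ∑ y, μm y * ε y :=
      Finset.sum_le_sum fun y _ => mul_le_mul_of_nonneg_left
        (by simpa [hsum] using K.dev_neg y) (hm y)
    simp only [mul_add, mul_sub, Finset.sum_add_distrib, Finset.sum_sub_distrib,
      ← Finset.sum_mul, hsum, one_mul] at e1 e2 e4 e5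
    simp only [mul_comm (μp _), mul_comm (μm _)] at e4 e5
    rw [optExpectation, ← hpdef]
    linarith

theorem optExpectation_le (M : OptimisticModel S A I H) (h : Fin H) (x : S) (a : A)
    {v : S → ℝ} {C : ℝ} (hv : ∀ y, v y ≤ C) : M.optExpectation h x a v ≤ C := by
  calc M.optExpectation h x a v ≤ ∑ y, M.optKernel h x a v y * C :=
        Finset.sum_le_sum fun y _ => mul_le_mul_of_nonneg_left (hv y)
          ((M.optKernel_mem h x a v).p_nonneg y)
    _ = C := by rw [← Finset.sum_mul, M.sum_optKernel, one_mul]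

/-- The bonus: the largest gain in the expectation of `v` over the reference expectation that
transition probabilities in the confidence set achieve. -/
noncomputable def bonus (M : OptimisticModel S A I H) (h : Fin H) (v : S → ℝ) (x : S) (a : A) :
    ℝ :=
  M.optExpectation h x a v - ∑ y, M.Phat h x a y * v y

theorem bonus_nonneg (M : OptimisticModel S A I H) (h : Fin H) (v : S → ℝ) (x : S) (a : A) :
    0 ≤ M.bonus h v x a := by
  have := (M.inConfidenceCone_Phat h x a).sum_le v
  rw [M.Phat_transition.sum_one, mul_one] at this
  exact sub_nonneg.mpr this

theorem backup_bonus (M : OptimisticModel S A I H) (h : Fin H) (v : S → ℝ) (x : S)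
    (a : A) : M.backup h x a (M.bonus h v x a) v = M.r h x a + M.optExpectation h x a v := by
  rw [backup, bonus]
  ring

end OptimisticModel

/-! ### The Lagrangian, collected by primal variables -/

namespace OptimisticModel

variable {S A I : Type*} [Fintype S] [Fintype A] {H : ℕ}

/-- Summation by parts for the flow constraints. -/
theorem sum_mul_inflow_sub_outflow (M : OptimisticModel S A I H) (q : Fin H → S → A → S → ℝ)
    (β : Fin (H + 1) → S → ℝ) (hβ : ∀ x, β (Fin.last H) x = 0) :
    ∑ h, ∑ x, β h.castSucc x * (M.inflow q h x - outflow q h x) =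
      M.initialValue β +
        ∑ h, ∑ x, ∑ a, ∑ y, q h x a y * (β h.succ y - β h.castSucc x) := by
  have hout : ∑ h, ∑ x, β h.castSucc x * outflow q h x =
      ∑ h, ∑ x, ∑ a, ∑ y, q h x a y * β h.castSucc x := by
    simp only [outflow, Finset.mul_sum, mul_comm]
  have hin : ∑ h, ∑ x, β h.castSucc x * M.inflow q h x =
      M.initialValue β + ∑ h, ∑ x, ∑ a, ∑ y, q h x a y * β h.succ y := by
    cases H with
    | zero =>
      have h0 : ∀ x, β 0 x = 0 := hβ
      simp [initialValue, h0]
    | succ n =>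
      -- The first inflow is `α`, and the mass leaving the last stage meets the terminal value zero;
      -- the other terms match after a shift by one stage.
      rw [Fin.sum_univ_succ, Fin.sum_univ_castSucc (f := fun h => ∑ x, ∑ a, ∑ y,
        q h x a y * β h.succ y)]
      have hlast : ∀ y, β (Fin.last n).succ y = 0 := hβ
      simp only [hlast, mul_zero, Finset.sum_const_zero, add_zero]
      congr 1
      · simp [inflow, initialValue, mul_comm]
      · refine Finset.sum_congr rfl fun k _ => ?_
        have hk : ∀ y, M.inflow q k.succ y = ∑ z, ∑ a, q k.castSucc z a y := fun y => by
          rw [inflow, if_neg (by simp)]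
          rfl
        simp only [hk, Finset.mul_sum]
        rw [Finset.sum_comm]
        refine Finset.sum_congr rfl fun z _ => ?_
        rw [Finset.sum_comm]
        refine Finset.sum_congr rfl fun a _ => Finset.sum_congr rfl fun y _ => ?_
        rw [mul_comm]
        rfl
  simp only [mul_sub, Finset.sum_sub_distrib]
  rw [hin, hout]
  ring

/-- The flow constraints annihilate the left side of the summation by parts. The result can be
compared with the primal objective term by term. -/
theorem PrimalFeasible.initialValue_eq {M : OptimisticModel S A I H}
    {q ε : Fin H → S → A → S → ℝ} (hq : M.PrimalFeasible q ε) (β : Fin (H + 1) → S → ℝ)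
    (hβ : ∀ x, β (Fin.last H) x = 0) :
    M.initialValue β = ∑ h, ∑ x, ∑ a, ∑ y, q h x a y * (β h.castSucc x - β h.succ y) := by
  have h1 := M.sum_mul_inflow_sub_outflow q β hβ
  simp only [hq.flow, sub_self, mul_zero, Finset.sum_const_zero] at h1
  have h2 : ∑ h, ∑ x, ∑ a, ∑ y, q h x a y * (β h.castSucc x - β h.succ y) =
      -∑ h, ∑ x, ∑ a, ∑ y, q h x a y * (β h.succ y - β h.castSucc x) := by
    simp only [← Finset.sum_neg_distrib]
    simp only [← mul_neg, neg_sub]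
  linarith

theorem PrimalFeasible.inConfidenceCone {M : OptimisticModel S A I H}
    {q ε : Fin H → S → A → S → ℝ} (hq : M.PrimalFeasible q ε) (h : Fin H) (x : S) (a : A) :
    M.InConfidenceCone h x a (q h x a) (ε h x a) :=
  ⟨hq.q_nonneg h x a, hq.ε_nonneg h x a, hq.dev_pos h x a, hq.dev_neg h x a,
    fun i => hq.conf h i x a⟩

variable [Fintype I]

/-- The coefficient of `q h x a y` in the Lagrangian. -/
def flowCoeff (M : OptimisticModel S A I H) (m : Multipliers S A I H)
    (β : Fin (H + 1) → S → ℝ) (h : Fin H) (x : S) (a : A) (y : S) : ℝ :=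
  M.r h x a + (β h.succ y - β h.castSucc x) - m.μp h x a y + m.μm h x a y
    + ∑ z, M.Phat h x a z * (m.μp h x a z - m.μm h x a z) + ∑ i, m.μ h i x a * M.b h i x a

/-- The coefficient of `ε h x a y` in the Lagrangian. -/
def deviationCoeff (M : OptimisticModel S A I H) (m : Multipliers S A I H)
    (h : Fin H) (x : S) (a : A) (y : S) : ℝ :=
  m.μp h x a y + m.μm h x a y - ∑ i, m.μ h i x a * M.w h i y

theorem lagrangian_eq (M : OptimisticModel S A I H) (q ε : Fin H → S → A → S → ℝ)
    (m : Multipliers S A I H) (β : Fin (H + 1) → S → ℝ) (hβ : ∀ x, β (Fin.last H) x = 0)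
    (hm : ∀ h x, m.β h x = β h.castSucc x) :
    M.lagrangian q ε m = M.initialValue β
      + ∑ h, ∑ x, ∑ a, ∑ y, q h x a y * M.flowCoeff m β h x a y
      + ∑ h, ∑ x, ∑ a, ∑ y, ε h x a y * M.deviationCoeff m h x a y := by
  have hswap : ∀ h : Fin H, ∑ i, ∑ x, ∑ a, m.μ h i x a *
      (M.b h i x a * ∑ y, q h x a y - ∑ y, M.w h i y * ε h x a y) =
      ∑ x, ∑ a, ∑ i, m.μ h i x a *
      (M.b h i x a * ∑ y, q h x a y - ∑ y, M.w h i y * ε h x a y) := fun h => by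
    rw [Finset.sum_comm]
    exact Finset.sum_congr rfl fun x _ => Finset.sum_comm
  rw [lagrangian, primalObj]
  simp only [hm, M.sum_mul_inflow_sub_outflow q β hβ, hswap]
  suffices key : ∑ h, ∑ x, ∑ a, ∑ y, q h x a y * M.r h x a
      + ∑ h, ∑ x, ∑ a, ∑ y, q h x a y * (β h.succ y - β h.castSucc x)
      + ∑ h, ∑ x, ∑ a, ∑ y,
        m.μp h x a y * (ε h x a y - (q h x a y - M.Phat h x a y * ∑ z, q h x a z))
      + ∑ h, ∑ x, ∑ a, ∑ y,
        m.μm h x a y * (ε h x a y - (M.Phat h x a y * ∑ z, q h x a z - q h x a y))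
      + ∑ h, ∑ x, ∑ a, ∑ i,
        m.μ h i x a * (M.b h i x a * ∑ y, q h x a y - ∑ y, M.w h i y * ε h x a y)
      = ∑ h, ∑ x, ∑ a, ∑ y, q h x a y * M.flowCoeff m β h x a y
      + ∑ h, ∑ x, ∑ a, ∑ y, ε h x a y * M.deviationCoeff m h x a y by
    rw [add_assoc (M.initialValue β), ← key]
    ring
  simp only [← Finset.sum_add_distrib (s := (Finset.univ : Finset (Fin H)))]
  refine Finset.sum_congr rfl fun h _ => ?_
  simp only [← Finset.sum_add_distrib (s := (Finset.univ : Finset S))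
    (f := fun x => ∑ a : A, _)]
  simp only [← Finset.sum_add_distrib]
  refine Finset.sum_congr rfl fun x _ => Finset.sum_congr rfl fun a _ => ?_
  have h1 : ∑ i, m.μ h i x a * ∑ y, M.w h i y * ε h x a y =
      ∑ y, ε h x a y * ∑ i, m.μ h i x a * M.w h i y := by
    simp only [Finset.mul_sum]
    rw [Finset.sum_comm]
    exact Finset.sum_congr rfl fun i _ => Finset.sum_congr rfl fun y _ => by ring
  have h2 : ∑ i, m.μ h i x a * (M.b h i x a * ∑ y, q h x a y) =
      ∑ y, q h x a y * ∑ i, m.μ h i x a * M.b h i x a := by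
    rw [← Finset.sum_mul, Finset.mul_sum]
    exact Finset.sum_congr rfl fun i _ => by ring
  have h3 : ∑ y, (m.μp h x a y - m.μm h x a y) * (M.Phat h x a y * ∑ z, q h x a z) =
      ∑ y, q h x a y * ∑ z, M.Phat h x a z * (m.μp h x a z - m.μm h x a z) := by
    rw [← Finset.sum_mul, Finset.mul_sum]
    exact Finset.sum_congr rfl fun i _ => by ring
  simp only [mul_sub (m.μ h _ x a), Finset.sum_sub_distrib, h1, h2]
  -- The exchange `h3` holds only after summing over `y`. Its two sides are inserted as a zero, so
  -- that the remaining identity holds for each `y`.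
  rw [← sub_eq_zero, ← sub_eq_zero.mpr h3]
  simp only [← Finset.sum_add_distrib, ← Finset.sum_sub_distrib]
  refine Finset.sum_congr rfl fun y _ => ?_
  rw [flowCoeff, deviationCoeff]
  ring

end OptimisticModel

/-! ### The dual function and elimination of multipliers -/

namespace OptimisticModel

variable {S A I : Type*} {H : ℕ}

theorem piSingle_nonneg [DecidableEq S] [DecidableEq A] (h : Fin H) (x : S) (a : A) (y : S)
    {t : ℝ} (ht : 0 ≤ t) :
    0 ≤ (Pi.single h (Pi.single x (Pi.single a (Pi.single y t))) : Fin H → S → A → S → ℝ) := by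
  simpa only [Pi.single_nonneg] using ht

variable [Fintype S] [Fintype A] [Fintype I]

theorem sum_piSingle_mul [DecidableEq S] [DecidableEq A] (C : Fin H → S → A → S → ℝ)
    (h : Fin H) (x : S) (a : A) (y : S) (t : ℝ) :
    ∑ h', ∑ x', ∑ a', ∑ y',
      (Pi.single h (Pi.single x (Pi.single a (Pi.single y t))) : Fin H → S → A → S → ℝ)
        h' x' a' y' * C h' x' a' y' = t * C h x a y := by
  rw [Finset.sum_eq_single h (fun h' _ hh => by simp [hh]) (by simp), Pi.single_eq_same,
    Finset.sum_eq_single x (fun x' _ hx => by simp [hx]) (by simp), Pi.single_eq_same,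
    Finset.sum_eq_single a (fun a' _ ha => by simp [ha]) (by simp), Pi.single_eq_same,
    Finset.sum_eq_single y (fun y' _ hy => by simp [hy]) (by simp), Pi.single_eq_same]

/-- The dual function is finite exactly if all coefficients of the Lagrangian are nonpositive. -/
theorem isDualValue_iff (M : OptimisticModel S A I H) (m : Multipliers S A I H)
    (β : Fin (H + 1) → S → ℝ) (hβ : ∀ x, β (Fin.last H) x = 0)
    (hm : ∀ h x, m.β h x = β h.castSucc x) (v : ℝ) :
    M.IsDualValue m v ↔ m.Nonneg ∧ v = M.initialValue β ∧
      (∀ h x a y, M.flowCoeff m β h x a y ≤ 0) ∧ ∀ h x a y, M.deviationCoeff m h x a y ≤ 0 := by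
  classical
  have hL := fun q ε => M.lagrangian_eq q ε m β hβ hm
  have h0 : M.lagrangian 0 0 m = M.initialValue β := by
    rw [hL]
    simp
  have hlub : (∀ h x a y, M.flowCoeff m β h x a y ≤ 0) →
      (∀ h x a y, M.deviationCoeff m h x a y ≤ 0) →
      IsLUB {l : ℝ | ∃ q ε : Fin H → S → A → S → ℝ, (∀ h x a y, 0 ≤ q h x a y) ∧
      (∀ h x a y, 0 ≤ ε h x a y) ∧ l = M.lagrangian q ε m} (M.initialValue β) := by
    intro hF hD
    refine IsGreatest.isLUB ⟨⟨0, 0, fun _ _ _ _ => le_rfl, fun _ _ _ _ => le_rfl, h0.symm⟩, ?_⟩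
    rintro _ ⟨q, ε, hq, hε, rfl⟩
    rw [hL]
    have e1 : ∑ h, ∑ x, ∑ a, ∑ y, q h x a y * M.flowCoeff m β h x a y ≤ 0 :=
      Finset.sum_nonpos fun h _ => Finset.sum_nonpos fun x _ => Finset.sum_nonpos fun a _ =>
        Finset.sum_nonpos fun y _ =>
          mul_nonpos_of_nonneg_of_nonpos (hq h x a y) (hF h x a y)
    have e2 : ∑ h, ∑ x, ∑ a, ∑ y, ε h x a y * M.deviationCoeff m h x a y ≤ 0 :=
      Finset.sum_nonpos fun h _ => Finset.sum_nonpos fun x _ => Finset.sum_nonpos fun a _ =>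
        Finset.sum_nonpos fun y _ =>
          mul_nonpos_of_nonneg_of_nonpos (hε h x a y) (hD h x a y)
    linarith
  have hray : ∀ c : ℝ, (∀ t, 0 ≤ t → M.initialValue β + t * c ≤ v) → c ≤ 0 := by
    intro c hc
    by_contra hpos
    push Not at hpos
    have e0 := hc 0 le_rfl
    -- At this point of the ray the affine function equals `v + 1`.
    have e1 := hc ((v - M.initialValue β + 1) / c) (div_nonneg (by linarith) hpos.le)
    rw [div_mul_cancel₀ _ hpos.ne'] at e1
    linarith
  constructor
  · rintro ⟨hn, hv⟩
    have hF : ∀ h x a y, M.flowCoeff m β h x a y ≤ 0 := fun h x a y => hray _ fun t ht => by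
      refine hv.1 ⟨_, 0, fun h' x' a' y' => piSingle_nonneg h x a y ht h' x' a' y',
        fun _ _ _ _ => le_rfl, ?_⟩
      rw [hL, sum_piSingle_mul]
      simp
    have hD : ∀ h x a y, M.deviationCoeff m h x a y ≤ 0 := fun h x a y => hray _ fun t ht => by
      refine hv.1 ⟨0, _, fun _ _ _ _ => le_rfl,
        fun h' x' a' y' => piSingle_nonneg h x a y ht h' x' a' y', ?_⟩
      rw [hL, sum_piSingle_mul]
      simp
    exact ⟨hn, hv.unique (hlub hF hD), hF, hD⟩
  · rintro ⟨hn, rfl, hF, hD⟩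
    exact ⟨hn, hlub hF hD⟩

/-- Eliminating the inequality multipliers from the dual program. -/
theorem exists_isDualValue_iff (M : OptimisticModel S A I H)
    (β : Fin (H + 1) → S → ℝ) (hβ : ∀ x, β (Fin.last H) x = 0) (v : ℝ) :
    (∃ m : Multipliers S A I H, (∀ h x, m.β h x = β h.castSucc x) ∧ M.IsDualValue m v) ↔
      (v = M.initialValue β ∧
        ∀ h x a, M.backup h x a (M.bonus h (β h.succ) x a) (β h.succ) ≤ β h.castSucc x) := by
  simp only [backup_bonus]
  have hiff : ∀ h x a, M.r h x a + M.optExpectation h x a (β h.succ) ≤ β h.castSucc x ↔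
      M.optExpectation h x a (β h.succ) ≤ β h.castSucc x - M.r h x a := fun h x a => by
    rw [le_sub_iff_add_le']
  simp only [hiff, optExpectation_le_iff]
  constructor
  · rintro ⟨m, hm, hd⟩
    obtain ⟨hn, hv, hF, hD⟩ := (M.isDualValue_iff m β hβ hm v).1 hd
    refine ⟨hv, fun h x a => ⟨m.μp h x a, m.μm h x a, fun i => m.μ h i x a, hn.μp h x a,
      hn.μm h x a, fun i => hn.μ h i x a, fun y => ?_, fun y => ?_⟩⟩
    · exact sub_nonpos.mp (hD h x a y)
    · have := hF h x a y
      rw [flowCoeff] at this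
      linarith
  · rintro ⟨hv, hx⟩
    -- Only `β` couples different stages, states and actions, so the certificates may be chosen
    -- independently.
    choose μp μm μ hp hm hμ hD hF using hx
    refine ⟨⟨fun h x => β h.castSucc x, μp, μm, fun h i x a => μ h x a i⟩, fun _ _ => rfl,
      (M.isDualValue_iff _ β hβ (fun _ _ => rfl) v).2
        ⟨⟨hp, hm, fun h i x a => hμ h x a i⟩, hv, fun h x a y => ?_, fun h x a y => ?_⟩⟩
    · have := hF h x a y
      rw [flowCoeff]
      linarith
    · exact sub_nonpos.mpr (hD h x a y)

/-- Weak duality. -/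
theorem PrimalFeasible.primalObj_le {M : OptimisticModel S A I H}
    {q ε : Fin H → S → A → S → ℝ} (hq : M.PrimalFeasible q ε) {m : Multipliers S A I H} {v : ℝ}
    (hm : M.IsDualValue m v) : M.primalObj q ≤ v := by
  refine le_trans ?_ (hm.2.1 ⟨q, ε, hq.q_nonneg, hq.ε_nonneg, rfl⟩)
  have e0 : ∑ h, ∑ x, m.β h x * (M.inflow q h x - outflow q h x) = 0 := by
    simp [hq.flow]
  have e1 : 0 ≤ ∑ h, ∑ x, ∑ a, ∑ y,
      m.μp h x a y * (ε h x a y - (q h x a y - M.Phat h x a y * ∑ z, q h x a z)) :=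
    Finset.sum_nonneg fun h _ => Finset.sum_nonneg fun x _ => Finset.sum_nonneg fun a _ =>
      Finset.sum_nonneg fun y _ =>
        mul_nonneg (hm.1.μp h x a y) (sub_nonneg.mpr (hq.dev_pos h x a y))
  have e2 : 0 ≤ ∑ h, ∑ x, ∑ a, ∑ y,
      m.μm h x a y * (ε h x a y - (M.Phat h x a y * ∑ z, q h x a z - q h x a y)) :=
    Finset.sum_nonneg fun h _ => Finset.sum_nonneg fun x _ => Finset.sum_nonneg fun a _ =>
      Finset.sum_nonneg fun y _ =>
        mul_nonneg (hm.1.μm h x a y) (sub_nonneg.mpr (hq.dev_neg h x a y))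
  have e3 : 0 ≤ ∑ h, ∑ i, ∑ x, ∑ a,
      m.μ h i x a * (M.b h i x a * ∑ y, q h x a y - ∑ y, M.w h i y * ε h x a y) :=
    Finset.sum_nonneg fun h _ => Finset.sum_nonneg fun i _ => Finset.sum_nonneg fun x _ =>
      Finset.sum_nonneg fun a _ =>
        mul_nonneg (hm.1.μ h i x a) (sub_nonneg.mpr (hq.conf h i x a))
  rw [lagrangian]
  linarith

end OptimisticModel

/-! ### The Bellman solution, strong duality and complementary slackness -/

namespace OptimisticModel

variable {S A I : Type*} [Fintype S] {H : ℕ}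

theorem initialValue_mono (M : OptimisticModel S A I H) {β β' : Fin (H + 1) → S → ℝ}
    (hβ : ∀ x, β 0 x ≤ β' 0 x) : M.initialValue β ≤ M.initialValue β' :=
  Finset.sum_le_sum fun x _ => mul_le_mul_of_nonneg_left (hβ x) (M.α_nonneg x)

/-- The state distribution in stage `k` of the Markov chain with transition kernel `K`
started from `α`. -/
def stateDist (M : OptimisticModel S A I H) (K : Fin H → S → S → ℝ) : ℕ → S → ℝ
  | 0 => M.α
  | k + 1 => fun y => if hk : k < H then ∑ x, M.stateDist K k x * K ⟨k, hk⟩ x y else 0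

theorem stateDist_nonneg (M : OptimisticModel S A I H) {K : Fin H → S → S → ℝ}
    (hK : ∀ h x y, 0 ≤ K h x y) (k : ℕ) (x : S) : 0 ≤ M.stateDist K k x := by
  induction k generalizing x with
  | zero => exact M.α_nonneg x
  | succ k ih =>
    rw [stateDist]
    split_ifs with hk
    · exact Finset.sum_nonneg fun z _ => mul_nonneg (ih z) (hK _ z x)
    · exact le_rfl

theorem InConfidenceCone.smul {M : OptimisticModel S A I H} {h : Fin H} {x : S} {a : A}
    {p ε : S → ℝ} (hp : M.InConfidenceCone h x a p ε) {c : ℝ} (hc : 0 ≤ c) :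
    M.InConfidenceCone h x a (fun y => c * p y) (fun y => c * ε y) := by
  refine ⟨fun y => mul_nonneg hc (hp.p_nonneg y), fun y => mul_nonneg hc (hp.ε_nonneg y),
    fun y => ?_, fun y => ?_, fun i => ?_⟩
  · have := mul_le_mul_of_nonneg_left (hp.dev_pos y) hc
    rw [← Finset.mul_sum]
    linarith
  · have := mul_le_mul_of_nonneg_left (hp.dev_neg y) hc
    rw [← Finset.mul_sum]
    linarith
  · have := mul_le_mul_of_nonneg_left (hp.conf i) hc
    rw [← Finset.mul_sum]
    simp only [mul_left_comm _ c]
    rw [← Finset.mul_sum]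
    linarith

variable [Fintype A] [Fintype I]

section Solution

variable [Nonempty A]

/-- The solution of the optimistic Bellman equations, by backward recursion. -/
noncomputable def optValue (M : OptimisticModel S A I H) (h : Fin (H + 1)) : S → ℝ :=
  Fin.reverseInduction (motive := fun _ => S → ℝ) (fun _ => 0)
    (fun h v x => Finset.univ.sup' Finset.univ_nonempty
      fun a => M.r h x a + M.optExpectation h x a v) h

theorem optValue_last (M : OptimisticModel S A I H) (x : S) : M.optValue (Fin.last H) x = 0 := by
  rw [optValue, Fin.reverseInduction_last]

theorem optValue_castSucc (M : OptimisticModel S A I H) (h : Fin H) (x : S) :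
    M.optValue h.castSucc x = Finset.univ.sup' Finset.univ_nonempty
      fun a => M.r h x a + M.optExpectation h x a (M.optValue h.succ) := by
  rw [optValue, Fin.reverseInduction_castSucc]
  rfl

theorem le_optValue (M : OptimisticModel S A I H) (h : Fin H) (x : S) (a : A) :
    M.r h x a + M.optExpectation h x a (M.optValue h.succ) ≤ M.optValue h.castSucc x := by
  rw [optValue_castSucc]
  exact Finset.le_sup' (fun a => M.r h x a + M.optExpectation h x a (M.optValue h.succ))
    (Finset.mem_univ a)

theorem exists_optValue_eq (M : OptimisticModel S A I H) (h : Fin H) (x : S) :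
    ∃ a, M.optValue h.castSucc x = M.r h x a + M.optExpectation h x a (M.optValue h.succ) := by
  obtain ⟨a, -, ha⟩ := Finset.exists_mem_eq_sup' Finset.univ_nonempty
    fun a => M.r h x a + M.optExpectation h x a (M.optValue h.succ)
  exact ⟨a, by rw [optValue_castSucc, ha]⟩

/-- The optimal bonus function. -/
noncomputable def optBonus (M : OptimisticModel S A I H) (h : Fin H) (x : S) (a : A) : ℝ :=
  M.bonus h (M.optValue h.succ) x a

theorem backup_optBonus (M : OptimisticModel S A I H) (h : Fin H) (x : S) (a : A) :
    M.backup h x a (M.optBonus h x a) (M.optValue h.succ) =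
      M.r h x a + M.optExpectation h x a (M.optValue h.succ) :=
  M.backup_bonus h _ x a

theorem bellmanFeasible_optValue (M : OptimisticModel S A I H) :
    M.BellmanFeasible M.optBonus M.optValue :=
  ⟨M.optValue_last, fun h x a => (M.backup_optBonus h x a).trans_le (M.le_optValue h x a)⟩

/-- Backward induction at a maximizing action. As the bonus is frozen at `optValue`, only the `Phat`
average varies, and it is monotone. -/
theorem BellmanFeasible.optValue_le {M : OptimisticModel S A I H} {β : Fin (H + 1) → S → ℝ}
    (hβ : M.BellmanFeasible M.optBonus β) (h : Fin (H + 1)) (x : S) :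
    M.optValue h x ≤ β h x := by
  induction h using Fin.reverseInduction generalizing x with
  | last => rw [M.optValue_last, hβ.1]
  | cast h ih =>
    obtain ⟨a, ha⟩ := M.exists_optValue_eq h x
    rw [ha, ← backup_optBonus]
    refine le_trans ?_ (hβ.2 h x a)
    rw [backup, backup]
    gcongr with y
    · exact M.Phat_transition.nonneg h x a y
    · exact ih y

theorem exists_isDualValue_optValue (M : OptimisticModel S A I H) :
    ∃ m : Multipliers S A I H, (∀ h x, m.β h x = M.optValue h.castSucc x) ∧
      M.IsDualValue m (M.initialValue M.optValue) :=
  (M.exists_isDualValue_iff _ M.optValue_last _).2 ⟨rfl, M.bellmanFeasible_optValue.2⟩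

theorem optValue_le_horizon (M : OptimisticModel S A I H) (h : Fin (H + 1)) (x : S) :
    M.optValue h x ≤ (H : ℝ) - ((h : ℕ) : ℝ) := by
  induction h using Fin.reverseInduction generalizing x with
  | last => rw [M.optValue_last, Fin.val_last, sub_self]
  | cast h ih =>
    obtain ⟨a, ha⟩ := M.exists_optValue_eq h x
    have h1 := M.optExpectation_le h x a ih
    have h2 := M.r_le_one h x a
    rw [ha, Fin.val_castSucc]
    rw [Fin.val_succ] at h1
    push_cast at h1
    linarith

end Solution

/-- Strong duality: following an optimal action and an optimal kernel in every stage attains the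
optimal Bellman value. -/
theorem exists_primalFeasible_eq [Nonempty A] (M : OptimisticModel S A I H) :
    ∃ q ε, M.PrimalFeasible q ε ∧ M.initialValue M.optValue = M.primalObj q := by
  classical
  choose π hπ using M.exists_optValue_eq
  set K : Fin H → S → S → ℝ := fun h x => M.optKernel h x (π h x) (M.optValue h.succ) with hK
  have hKn : ∀ h x y, 0 ≤ K h x y := fun h x y => (M.optKernel_mem h x _ _).p_nonneg y
  set d := M.stateDist K with hd
  have hdn : ∀ k x, 0 ≤ d k x := M.stateDist_nonneg hKn
  -- All mass at `x` goes to the maximizing action. Multiplying the optimal kernel and its deviation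
  -- by this mass stays in the cone by homogeneity.
  set c : Fin H → S → A → ℝ := fun h x a => if a = π h x then d h x else 0 with hc
  have hcn : ∀ h x a, 0 ≤ c h x a := fun h x a => by
    simp only [hc]
    split_ifs
    · exact hdn _ _
    · exact le_rfl
  set q : Fin H → S → A → S → ℝ := fun h x a y =>
    c h x a * M.optKernel h x a (M.optValue h.succ) y with hq
  set ε : Fin H → S → A → S → ℝ := fun h x a y =>
    c h x a * M.optDeviation h x a (M.optValue h.succ) y with hε
  have hcone : ∀ h x a, M.InConfidenceCone h x a (q h x a) (ε h x a) := fun h x a =>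
    (M.optKernel_mem h x a _).smul (hcn h x a)
  have hqa : ∀ h x y, ∑ a, q h x a y = d h x * K h x y := fun h x y => by
    simp [hq, hc, hK, ite_mul]
  have hfeas : M.PrimalFeasible q ε := by
    refine ⟨fun h x a => (hcone h x a).p_nonneg, fun h x a => (hcone h x a).ε_nonneg,
      fun h x => ?_, fun h x a => (hcone h x a).dev_pos, fun h x a => (hcone h x a).dev_neg,
      fun h i x a => (hcone h x a).conf i⟩
    have hout : outflow q h x = d h x := by
      rw [outflow, Finset.sum_comm]
      simp only [hqa]
      rw [← Finset.mul_sum, M.sum_optKernel, mul_one]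
    rw [hout, inflow]
    obtain ⟨k, hk⟩ := h
    cases k with
    | zero => rfl
    | succ k =>
      rw [if_neg (Nat.succ_ne_zero k)]
      simp only [hqa]
      exact dif_pos (Nat.lt_of_succ_lt hk)
  refine ⟨q, ε, hfeas, ?_⟩
  rw [hfeas.initialValue_eq _ M.optValue_last, primalObj]
  refine Finset.sum_congr rfl fun h _ => Finset.sum_congr rfl fun x _ =>
    Finset.sum_congr rfl fun a _ => ?_
  by_cases ha : a = π h x
  · subst ha
    have h1 := M.sum_optKernel h x (π h x) (M.optValue h.succ)
    simp only [hq, mul_sub, Finset.sum_sub_distrib, mul_assoc]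
    simp only [← Finset.mul_sum, ← Finset.sum_mul, h1, one_mul]
    rw [hπ, optExpectation]
    ring
  · simp [hq, hc, ha]

/-- Complementary slackness. -/
theorem PrimalFeasible.optValue_eq [Nonempty A] {M : OptimisticModel S A I H}
    {q ε : Fin H → S → A → S → ℝ} (hq : M.PrimalFeasible q ε)
    (hopt : M.initialValue M.optValue ≤ M.primalObj q) {h : Fin H} {x : S} {a : A}
    (hpos : 0 < ∑ y, q h x a y) :
    M.optValue h.castSucc x = M.r h x a + M.optExpectation h x a (M.optValue h.succ) := by
  -- `D` splits the gap between `initialValue` and `primalObj`. Each term dominates mass times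
  -- Bellman slack, so a nonpositive gap leaves no slack where mass is positive.
  set D : Fin H → S → A → ℝ := fun h x a =>
    ∑ y, q h x a y * (M.optValue h.castSucc x - M.optValue h.succ y)
      - ∑ y, q h x a y * M.r h x a with hD
  have hDge : ∀ h x a, (∑ y, q h x a y) * (M.optValue h.castSucc x -
      (M.r h x a + M.optExpectation h x a (M.optValue h.succ))) ≤ D h x a := fun h x a => by
    have h1 := (hq.inConfidenceCone h x a).sum_le (M.optValue h.succ)
    simp only [hD, mul_sub, Finset.sum_sub_distrib, ← Finset.sum_mul]
    linarith
  have hmass : ∀ h x a, 0 ≤ ∑ y, q h x a y := fun h x a =>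
    Finset.sum_nonneg fun y _ => hq.q_nonneg h x a y
  have hDn : ∀ h x a, 0 ≤ D h x a := fun h x a =>
    (mul_nonneg (hmass h x a) (sub_nonneg.mpr (M.le_optValue h x a))).trans (hDge h x a)
  have hsum : ∑ h, ∑ x, ∑ a, D h x a ≤ 0 := by
    simp only [hD, Finset.sum_sub_distrib]
    rw [← hq.initialValue_eq _ M.optValue_last]
    rw [primalObj] at hopt
    linarith
  have hDle : D h x a ≤ ∑ h, ∑ x, ∑ a, D h x a :=
    calc D h x a ≤ ∑ a, D h x a :=
          Finset.single_le_sum (fun a _ => hDn h x a) (Finset.mem_univ a)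
      _ ≤ ∑ x, ∑ a, D h x a :=
          Finset.single_le_sum (f := fun x => ∑ a, D h x a)
            (fun x _ => Finset.sum_nonneg fun a _ => hDn h x a) (Finset.mem_univ x)
      _ ≤ ∑ h, ∑ x, ∑ a, D h x a :=
          Finset.single_le_sum (f := fun h => ∑ x, ∑ a, D h x a)
            (fun h _ => Finset.sum_nonneg fun x _ => Finset.sum_nonneg fun a _ => hDn h x a)
            (Finset.mem_univ h)
  have h1 := nonpos_of_mul_nonpos_right ((hDge h x a).trans (hDle.trans hsum)) hpos
  exact le_antisymm (sub_nonpos.mp h1) (M.le_optValue h x a)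

end OptimisticModel

/-! ### Optimism: policy values under the true transitions -/

section Values

variable {S A : Type*} [Fintype S] {H : ℕ}

/-- Total reward of `π` over the stages `σ 0, σ 1, …`, averaged over trajectories from `x`. -/
def stagesValue (P : Fin H → S → A → S → ℝ) (r : Fin H → S → A → ℝ) (π : Fin H → S → A)
    {n : ℕ} (σ : Fin n → Fin H) (x : S) : ℝ :=
  ∑ ω : Fin n → S,
    let s : Fin (n + 1) → S := Fin.cons x ω
    (∏ k, P (σ k) (s k.castSucc) (π (σ k) (s k.castSucc)) (s k.succ)) *
      ∑ k, r (σ k) (s k.castSucc) (π (σ k) (s k.castSucc))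

theorem sum_trajectory_cons {n : ℕ} (F : (Fin (n + 1) → S) → ℝ) :
    ∑ ω, F ω = ∑ y, ∑ ω : Fin n → S, F (Fin.cons y ω) := by
  rw [← (Fin.consEquiv fun _ : Fin (n + 1) => S).sum_comp, Fintype.sum_prod_type]
  rfl

theorem sum_trajectory_prob {P : Fin H → S → A → S → ℝ} (hP : IsTransition P)
    (π : Fin H → S → A) {n : ℕ} (σ : Fin n → Fin H) (x : S) :
    ∑ ω : Fin n → S, (∏ k, P (σ k) ((Fin.cons x ω : Fin (n + 1) → S) k.castSucc)
      (π (σ k) ((Fin.cons x ω : Fin (n + 1) → S) k.castSucc))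
      ((Fin.cons x ω : Fin (n + 1) → S) k.succ)) = 1 := by
  induction n generalizing x with
  | zero => simp
  | succ n ih =>
    rw [sum_trajectory_cons]
    simp only [Fin.prod_univ_succ, Fin.castSucc_zero, Fin.cons_zero, Fin.castSucc_succ,
      Fin.cons_succ]
    simp only [← Finset.mul_sum]
    have := fun y => ih (fun k => σ k.succ) y
    simp only [Fin.cons_succ] at this
    simp only [this, mul_one]
    exact hP.sum_one _ _ _

/-- The first reward is the same on all trajectories and their probabilities sum to one. With an
arbitrary stage map `σ`, the tail has the same form as the whole. -/
theorem stagesValue_succ {P : Fin H → S → A → S → ℝ} (hP : IsTransition P)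
    (r : Fin H → S → A → ℝ) (π : Fin H → S → A) {n : ℕ} (σ : Fin (n + 1) → Fin H) (x : S) :
    stagesValue P r π σ x = r (σ 0) x (π (σ 0) x) +
      ∑ y, P (σ 0) x (π (σ 0) x) y * stagesValue P r π (fun k => σ k.succ) y := by
  have h1 := fun y => sum_trajectory_prob hP π (fun k => σ k.succ) y
  simp only [stagesValue]
  rw [sum_trajectory_cons]
  simp only [Fin.prod_univ_succ, Fin.sum_univ_succ (n := n), Fin.castSucc_zero, Fin.cons_zero,
    Fin.castSucc_succ, Fin.cons_succ] at h1 ⊢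
  simp only [mul_add, Finset.sum_add_distrib, mul_assoc]
  simp only [← Finset.mul_sum, ← Finset.sum_mul, h1, one_mul, hP.sum_one]

/-- Induction on the number of remaining stages: `P`, with its absolute deviations as `ε`, lies in
the cone, so its expectations are at most `optExpectation`. -/
theorem stagesValue_le_optValue {I : Type*} [Fintype I] [Fintype A] [Nonempty A]
    (M : OptimisticModel S A I H) {P : Fin H → S → A → S → ℝ} (hP : IsTransition P)
    (hM : M.InConfidenceSet P) (π : Fin H → S → A) {n : ℕ} (σ : Fin n → Fin H)
    (h : Fin (H + 1)) (hn : (h : ℕ) + n = H) (hσ : ∀ k, (σ k : ℕ) = h + k) (x : S) :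
    stagesValue P M.r π σ x ≤ M.optValue h x := by
  induction n generalizing h x with
  | zero =>
    obtain rfl : h = Fin.last H := Fin.ext (by simpa using hn)
    simp [stagesValue, M.optValue_last]
  | succ n ih =>
    have h0 : h = (σ 0).castSucc := Fin.ext (by simpa using (hσ 0).symm)
    have hrec : ∀ y, stagesValue P M.r π (fun k => σ k.succ) y ≤ M.optValue (σ 0).succ y :=
      fun y => ih (fun k => σ k.succ) (σ 0).succ
        (by have := hσ 0; simp at this ⊢; omega)
        (fun k => by have := hσ 0; have := hσ k.succ; simp at *; omega) y
    rw [stagesValue_succ hP, h0]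
    refine le_trans ?_ (M.le_optValue (σ 0) x (π (σ 0) x))
    have h1 := (M.inConfidenceCone_of_inConfidenceSet hP hM (σ 0) x (π (σ 0) x)).sum_le
      (M.optValue (σ 0).succ)
    rw [hP.sum_one, mul_one] at h1
    refine add_le_add_right (le_trans (Finset.sum_le_sum fun y _ => ?_) h1) _
    exact mul_le_mul_of_nonneg_left (hrec y) (hP.nonneg _ _ _ _)

theorem optimalValue_le_optValue {I : Type*} [Fintype I] [Fintype A] [Nonempty A]
    (M : OptimisticModel S A I H) {P : Fin H → S → A → S → ℝ} (hP : IsTransition P)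
    (hM : M.InConfidenceSet P) (h : Fin (H + 1)) (x : S) :
    optimalValue P M.r h x ≤ M.optValue h x :=
  -- `policyValue` is by definition `stagesValue` along `stageAfter h`.
  ciSup_le fun π => stagesValue_le_optValue M hP hM π (stageAfter h) h (by omega)
    (fun _ => rfl) x

end Values

/-- The dual of the primal optimistic linear program is an optimistic Bellman linear program. -/
theorem mainTheorem1 {S A I : Type*} [Fintype S] [Fintype A] [Nonempty A] [Fintype I] {H : ℕ}
    (M : OptimisticModel S A I H) :
    ∃ (CB : Fin H → S → A → ℝ) (βs : Fin (H + 1) → S → ℝ)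
      (B : Fin H → (S → ℝ) → S → A → ℝ),
      -- the bonus is nonnegative, and is a function of the next-stage solution
      (∀ h x a, 0 ≤ CB h x a) ∧
      (∀ h v x a, 0 ≤ B h v x a) ∧
      (∀ h x a, CB h x a = B h (βs h.succ) x a) ∧
      -- eliminating the other multipliers from the dual leaves the Bellman program in `β`
      (∀ β : Fin (H + 1) → S → ℝ, (∀ x, β (Fin.last H) x = 0) → ∀ v : ℝ,
        (∃ m : Multipliers S A I H, (∀ h x, m.β h x = β h.castSucc x) ∧ M.IsDualValue m v) ↔
          (v = M.initialValue β ∧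
            ∀ h x a, M.backup h x a (B h (β h.succ) x a) (β h.succ) ≤ β h.castSucc x)) ∧
      -- `βs` is the optimal solution of the Bellman program with bonus `CB`:
      -- the componentwise least feasible point
      M.BellmanFeasible CB βs ∧
      (∀ β, M.BellmanFeasible CB β → ∀ h x, βs h x ≤ β h x) ∧
      IsLeast {v : ℝ | ∃ β, M.BellmanFeasible CB β ∧ v = M.initialValue β} (M.initialValue βs) ∧
      -- `βs` is also (the `β`-part of) an optimal solution of the dual program
      (∃ m : Multipliers S A I H, (∀ h x, m.β h x = βs h.castSucc x) ∧
        M.IsDualValue m (M.initialValue βs)) ∧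
      IsLeast {v : ℝ | ∃ m : Multipliers S A I H, M.IsDualValue m v} (M.initialValue βs) ∧
      -- strong duality with the primal program
      IsGreatest {v : ℝ | ∃ q ε, M.PrimalFeasible q ε ∧ v = M.primalObj q}
        (M.initialValue βs) ∧
      -- the policy extracted from any primal optimum attains equality
      (∀ q ε, M.PrimalOptimal q ε →
        (∀ h x a, 0 < OptimisticModel.inducedPolicy q h x a →
          βs h.castSucc x = M.backup h x a (CB h x a) (βs h.succ)) ∧
        ∃ π : Fin H → S → A, OptimisticModel.IsExtracted q π ∧
          ∀ h x, βs h.castSucc x = M.backup h x (π h x) (CB h x (π h x)) (βs h.succ)) ∧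
      -- optimism and boundedness
      (∀ P : Fin H → S → A → S → ℝ, IsTransition P → M.InConfidenceSet P →
        ∀ (h : Fin (H + 1)) (x : S),
          optimalValue P M.r h x ≤ βs h x ∧ βs h x ≤ (H : ℝ) - ((h : ℕ) : ℝ)) := by
  obtain ⟨q₀, ε₀, hq₀, hval⟩ := M.exists_primalFeasible_eq
  obtain ⟨m₀, hm₀, hd₀⟩ := M.exists_isDualValue_optValue
  refine ⟨M.optBonus, M.optValue, M.bonus, fun h x a => M.bonus_nonneg h _ x a,
    M.bonus_nonneg, fun _ _ _ => rfl, M.exists_isDualValue_iff, M.bellmanFeasible_optValue,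
    fun β hβ => hβ.optValue_le, ⟨⟨_, M.bellmanFeasible_optValue, rfl⟩, ?_⟩, ⟨m₀, hm₀, hd₀⟩,
    ⟨⟨m₀, hd₀⟩, ?_⟩, ⟨⟨q₀, ε₀, hq₀, hval⟩, ?_⟩, fun q ε hq => ?_, fun P hP hM h x =>
      ⟨optimalValue_le_optValue M hP hM h x, M.optValue_le_horizon h x⟩⟩
  · rintro _ ⟨β, hβ, rfl⟩
    exact M.initialValue_mono (hβ.optValue_le 0)
  · rintro v ⟨m, hm⟩
    exact hval.trans_le (hq₀.primalObj_le hm)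
  · rintro _ ⟨q, ε, hq, rfl⟩
    exact hq.primalObj_le hd₀
  · have hslack : ∀ h x a, 0 < OptimisticModel.inducedPolicy q h x a →
        M.optValue h.castSucc x = M.backup h x a (M.optBonus h x a) (M.optValue h.succ) := by
      intro h x a hpos
      rw [M.backup_optBonus]
      -- Comparison with `q₀` shows that an optimal `q` closes the duality gap.
      refine hq.1.optValue_eq (hval.trans_le (hq.2 q₀ ε₀ hq₀)) ?_
      refine (Finset.sum_nonneg fun y _ => hq.1.q_nonneg h x a y).lt_of_ne fun h0 => ?_
      rw [OptimisticModel.inducedPolicy, ← h0, zero_div] at hpos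
      exact hpos.false
    refine ⟨hslack, ?_⟩
    have hex : ∀ h x, ∃ a, (0 < OptimisticModel.outflow q h x →
        0 < OptimisticModel.inducedPolicy q h x a) ∧
        M.optValue h.castSucc x = M.backup h x a (M.optBonus h x a) (M.optValue h.succ) := by
      intro h x
      by_cases hpos : 0 < OptimisticModel.outflow q h x
      · obtain ⟨a, -, ha⟩ := Finset.exists_lt_of_sum_lt
          (s := Finset.univ) (f := fun _ : A => (0 : ℝ)) (g := fun a => ∑ y, q h x a y)
          (by simpa [OptimisticModel.outflow] using hpos)
        exact ⟨a, fun _ => div_pos ha hpos, hslack h x a (div_pos ha hpos)⟩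
      -- Without mass at `x` the policy is free, and a maximizing action gives the equality.
      · obtain ⟨a, ha⟩ := M.exists_optValue_eq h x
        exact ⟨a, fun h' => absurd h' hpos, by rw [M.backup_optBonus, ha]⟩
    choose π hπ₁ hπ₂ using hex
    exact ⟨π, hπ₁, hπ₂⟩
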